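/- **Conventions.** An almost contact metric manifold $(N,\phi,\xi,\eta,g)$ of dimension $2n+1$ is a smooth manifold $N$ of that dimension with a smooth $(1,1)$-tensor field $\phi$, a smooth vector field $\xi$, a smooth $1$-form $\eta$ and a Riemannian metric $g$ such that $\phi^2=-I+\eta\otimes\xi$, $\eta(\xi)=1$ and $g(\phi X,\phi Y)=g(X,Y)-\eta(X)\eta(Y)$. Put $\Phi(X,Y)=g(X,\phi Y)$. The manifold is cosymplectic if $d\eta=0$, $d\Phi=0$ and the structure is normal, i.e. $\phi^2[X,Y]+[\phi X,\phi Y]-\phi[\phi X,Y]-\phi[X,\phi Y]+2\,d\eta(X,Y)\,\xi=0$ for all vector fields $X,Y$ (where $2\,d\eta(X,Y)=X\eta(Y)-Y\eta(X)-\eta([X,Y])$). Let $M$ be an (immersed) submanifold of $N$ and, for $p\in M$, let $M_p=\{X\in T_pM : g(X,\xi(p))=0\}$. $M$ is a pointwise slant submanifold with slant function $\theta:M\to\mathbb R$ if at each $p\in M$ the angle between $\phi X$ and the space $M_p$ equals $\theta(p)$ for every nonzero $X\in M_p$; it is proper if moreover $\theta$ takes values in $[0,\frac{\pi}{2})$.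 For $Y$ tangent to $M$, let $TY$ be the component of $\phi Y$ tangent to $M$ (with respect to the $g$-orthogonal splitting $TN|_M=TM\oplus TM^{\perp}$). **Theorem 5.2.** Let $M$ be a proper pointwise slant submanifold of a cosymplectic manifold $(N,\phi,\xi,\eta,g)$. Then the smooth $2$-form $\Omega$ on $M$ defined by $\Omega(X,Y)=g(X,TY)$ is closed: $d\Omega=0$. -/

import Mathlib

open Bundle
open scoped Manifold ContDiff

/-! ### Differential forms on manifolds -/

section Forms

variable {d : ℕ} {M : Type*} [TopologicalSpace M] [ChartedSpace (EuclideanSpace ℝ (Fin d)) M]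

/-- A (not necessarily smooth) field of alternating `k`-linear forms on the tangent spaces of a
`d`-dimensional manifold without boundary. -/
abbrev DiffForm (d : ℕ) (M : Type*) [TopologicalSpace M]
    [ChartedSpace (EuclideanSpace ℝ (Fin d)) M] (k : ℕ) : Type _ :=
  ∀ x : M, TangentSpace (𝓡 d) x [⋀^Fin k]→L[ℝ] ℝ

namespace DiffForm

instance instFiniteDimensionalTangent (x : M) : FiniteDimensional ℝ (TangentSpace (𝓡 d) x) :=
  inferInstanceAs (FiniteDimensional ℝ (EuclideanSpace ℝ (Fin d)))

/-- The local representative of `α` in the preferred chart around `x₀`, that is, the pullback of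
`α` under the inverse of this chart, a form on (an open subset of) `ℝᵈ`. -/
noncomputable def chartRep {k : ℕ} (α : DiffForm d M k) (x₀ : M) :
    EuclideanSpace ℝ (Fin d) → EuclideanSpace ℝ (Fin d) [⋀^Fin k]→L[ℝ] ℝ :=
  fun y ↦ (α ((extChartAt (𝓡 d) x₀).symm y)).compContinuousLinearMap
    (mfderiv (𝓡 d) (𝓡 d) (extChartAt (𝓡 d) x₀).symm y)

theorem chartRep_apply {k : ℕ} (α : DiffForm d M k) (x₀ : M) (y : EuclideanSpace ℝ (Fin d))
    (v : Fin k → EuclideanSpace ℝ (Fin d)) :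
    α.chartRep x₀ y v = α ((extChartAt (𝓡 d) x₀).symm y)
      (fun j ↦ mfderiv (𝓡 d) (𝓡 d) (extChartAt (𝓡 d) x₀).symm y (v j)) := rfl

/-- Smoothness of a differential form: all its local representatives are smooth. -/
def IsSmooth {k : ℕ} (α : DiffForm d M k) : Prop :=
  ∀ x₀ : M, ContDiffOn ℝ ∞ (α.chartRep x₀) (extChartAt (𝓡 d) x₀).target

/-- The exterior derivative, computed in the preferred chart around each point. It is normalized
so that `dη (X, Y) = X (η Y) - Y (η X) - η [X, Y]` for a one-form `η`. -/
noncomputable def extDer {k : ℕ} (α : DiffForm d M k) : DiffForm d M (k + 1) :=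
  fun x ↦ (extDeriv (α.chartRep x) (extChartAt (𝓡 d) x x)).compContinuousLinearMap
    (mfderiv (𝓡 d) (𝓡 d) (extChartAt (𝓡 d) x) x)

theorem extDer_apply {k : ℕ} (α : DiffForm d M k) (x : M)
    (v : Fin (k + 1) → TangentSpace (𝓡 d) x) :
    α.extDer x v = extDeriv (α.chartRep x) (extChartAt (𝓡 d) x x)
      (fun j ↦ mfderiv (𝓡 d) (𝓡 d) (extChartAt (𝓡 d) x) x (v j)) := rfl

/-- A smooth form is closed if its exterior derivative vanishes identically. -/
def IsClosed {k : ℕ} (α : DiffForm d M k) : Prop :=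
  α.IsSmooth ∧ ∀ x : M, α.extDer x = 0

/-- A field of covectors, seen as a differential form of degree one. -/
noncomputable def ofCovector (η : ∀ x : M, TangentSpace (𝓡 d) x →L[ℝ] ℝ) : DiffForm d M 1 :=
  fun x ↦ ContinuousAlternatingMap.ofSubsingleton ℝ (TangentSpace (𝓡 d) x) ℝ (0 : Fin 1) (η x)

theorem continuous_bilin {x : M}
    (B : TangentSpace (𝓡 d) x →ₗ[ℝ] TangentSpace (𝓡 d) x →ₗ[ℝ] ℝ) :
    Continuous fun v : Fin 2 → TangentSpace (𝓡 d) x ↦ B (v 0) (v 1) := by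
  have : T2Space (TangentSpace (𝓡 d) x) := inferInstanceAs (T2Space (EuclideanSpace ℝ (Fin d)))
  let b := Module.finBasis ℝ (TangentSpace (𝓡 d) x)
  have h : (fun v : Fin 2 → TangentSpace (𝓡 d) x ↦ B (v 0) (v 1)) =
      fun v ↦ ∑ i, (b.coord i) (v 1) * (B.flip (b i)) (v 0) := by
    funext v
    conv_lhs => rw [← b.sum_repr (v 1)]
    simp only [map_sum, map_smul, smul_eq_mul, Module.Basis.coord_apply, LinearMap.flip_apply]
  rw [h]
  refine continuous_finsetSum _ fun i _ ↦ Continuous.mul ?_ ?_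
  · exact (LinearMap.continuous_of_finiteDimensional (b.coord i)).comp (continuous_apply 1)
  · exact (LinearMap.continuous_of_finiteDimensional (B.flip (b i))).comp (continuous_apply 0)

/-- The two-form `(X, Y) ↦ B X Y` given by a field `B` of alternating bilinear forms. -/
noncomputable def ofBilin
    (B : ∀ x : M, TangentSpace (𝓡 d) x →ₗ[ℝ] TangentSpace (𝓡 d) x →ₗ[ℝ] ℝ)
    (hB : ∀ (x : M) (X : TangentSpace (𝓡 d) x), B x X X = 0) : DiffForm d M 2 :=
  fun x ↦
    { toFun := fun v ↦ B x (v 0) (v 1)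
      map_update_add' := by
        intro _ v i a b
        fin_cases i <;> simp [Function.update]
      map_update_smul' := by
        intro _ v i c a
        fin_cases i <;> simp [Function.update]
      cont := continuous_bilin (B x)
      map_eq_zero_of_eq' := by
        intro v i j h hij
        fin_cases i <;> fin_cases j <;> simp_all }

@[simp] theorem ofBilin_apply
    (B : ∀ x : M, TangentSpace (𝓡 d) x →ₗ[ℝ] TangentSpace (𝓡 d) x →ₗ[ℝ] ℝ)
    (hB : ∀ (x : M) (X : TangentSpace (𝓡 d) x), B x X X = 0) (x : M)
    (X Y : TangentSpace (𝓡 d) x) : ofBilin B hB x ![X, Y] = B x X Y := rfl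

end DiffForm

end Forms

/-! ### Almost contact metric manifolds

The Riemannian metric `g` of the ambient manifold is the family of inner products on the tangent
spaces provided by `RiemannianBundle`, smooth by `IsContMDiffRiemannianBundle`. -/

section Contact

/-- An almost contact metric structure `(φ, ξ, η, g)` on a Riemannian manifold `(N, g)`. -/
structure AlmostContactMetric (k : ℕ) (N : Type*) [TopologicalSpace N]
    [ChartedSpace (EuclideanSpace ℝ (Fin k)) N] [IsManifold (𝓡 k) ∞ N]
    [RiemannianBundle (fun x : N ↦ TangentSpace (𝓡 k) x)] where
  /-- the smooth tensor field of type `(1, 1)` -/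
  φ : ContMDiffSection (𝓡 k) (EuclideanSpace ℝ (Fin k) →L[ℝ] EuclideanSpace ℝ (Fin k)) ∞
    (fun x : N ↦ TangentSpace (𝓡 k) x →L[ℝ] TangentSpace (𝓡 k) x)
  /-- the smooth vector field -/
  ξ : ContMDiffSection (𝓡 k) (EuclideanSpace ℝ (Fin k)) ∞ (fun x : N ↦ TangentSpace (𝓡 k) x)
  /-- the smooth one-form -/
  η : ∀ x : N, TangentSpace (𝓡 k) x →L[ℝ] ℝ
  η_smooth : (DiffForm.ofCovector η).IsSmooth
  φ_φ : ∀ (x : N) (X : TangentSpace (𝓡 k) x), φ x (φ x X) = -X + η x X • ξ x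
  η_ξ : ∀ x : N, η x (ξ x) = 1
  compatible : ∀ (x : N) (X Y : TangentSpace (𝓡 k) x),
    inner ℝ (φ x X) (φ x Y) = inner ℝ X Y - η x X * η x Y

namespace AlmostContactMetric

variable {k : ℕ} {N : Type*} [TopologicalSpace N] [ChartedSpace (EuclideanSpace ℝ (Fin k)) N]
  [IsManifold (𝓡 k) ∞ N] [RiemannianBundle (fun x : N ↦ TangentSpace (𝓡 k) x)]

theorem ξ_ne_zero (S : AlmostContactMetric k N) (x : N) : S.ξ x ≠ 0 := by
  intro h
  have := S.η_ξ x
  rw [h, map_zero] at this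
  exact zero_ne_one this

theorem φ_ξ (S : AlmostContactMetric k N) (x : N) : S.φ x (S.ξ x) = 0 := by
  have h1 : S.φ x (S.φ x (S.ξ x)) = 0 := by
    rw [S.φ_φ, S.η_ξ, one_smul, neg_add_cancel]
  have h2 := S.φ_φ x (S.φ x (S.ξ x))
  rw [h1, map_zero] at h2
  have h3 : S.φ x (S.ξ x) = S.η x (S.φ x (S.ξ x)) • S.ξ x := by
    rw [eq_comm, neg_add_eq_zero] at h2
    exact h2
  have h4 : S.η x (S.φ x (S.ξ x)) • S.φ x (S.ξ x) = 0 := by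
    rw [← map_smul, ← h3, h1]
  rcases smul_eq_zero.1 h4 with h | h
  · rw [h3, h, zero_smul]
  · exact h

theorem inner_ξ (S : AlmostContactMetric k N) (x : N) (X : TangentSpace (𝓡 k) x) :
    inner ℝ X (S.ξ x) = S.η x X := by
  have h := S.compatible x X (S.ξ x)
  rw [S.φ_ξ, inner_zero_right, S.η_ξ, mul_one] at h
  linarith

theorem η_φ (S : AlmostContactMetric k N) (x : N) (X : TangentSpace (𝓡 k) x) :
    S.η x (S.φ x X) = 0 := by
  have h1 : S.φ x (S.φ x (S.φ x X)) = -S.φ x X := by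
    rw [S.φ_φ x X, map_add, map_neg, map_smul, S.φ_ξ, smul_zero, add_zero]
  have h2 := S.φ_φ x (S.φ x X)
  rw [h1] at h2
  have h3 : S.η x (S.φ x X) • S.ξ x = 0 := left_eq_add.1 h2
  exact (smul_eq_zero.1 h3).resolve_right (S.ξ_ne_zero x)

theorem inner_φ_self (S : AlmostContactMetric k N) (x : N) (X : TangentSpace (𝓡 k) x) :
    inner ℝ X (S.φ x X) = 0 := by
  have h := S.compatible x X (S.φ x X)
  rw [S.φ_φ, inner_add_right, inner_neg_right, inner_smul_right, inner_ξ, η_φ,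
    real_inner_comm] at h
  linarith

/-- The fundamental two-form `Φ (X, Y) = g (X, φ Y)`. -/
noncomputable def fundamentalForm (S : AlmostContactMetric k N) : DiffForm k N 2 :=
  DiffForm.ofBilin (fun x ↦ (innerₗ (TangentSpace (𝓡 k) x)).compl₂ (S.φ x).toLinearMap)
    (fun x X ↦ S.inner_φ_self x X)

theorem fundamentalForm_apply (S : AlmostContactMetric k N) (x : N)
    (X Y : TangentSpace (𝓡 k) x) :
    S.fundamentalForm x ![X, Y] = inner ℝ X (S.φ x Y) := rfl

/-- The Nijenhuis tensor of `φ`, evaluated on two vector fields. -/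
noncomputable def nijenhuis (S : AlmostContactMetric k N)
    (X Y : ∀ x : N, TangentSpace (𝓡 k) x) (x : N) : TangentSpace (𝓡 k) x :=
  S.φ x (S.φ x (VectorField.mlieBracket (𝓡 k) X Y x))
    + VectorField.mlieBracket (𝓡 k) (fun y ↦ S.φ y (X y)) (fun y ↦ S.φ y (Y y)) x
    - S.φ x (VectorField.mlieBracket (𝓡 k) (fun y ↦ S.φ y (X y)) Y x)
    - S.φ x (VectorField.mlieBracket (𝓡 k) X (fun y ↦ S.φ y (Y y)) x)

/-- Normality. With the convention `2 dη (X, Y) = X (η Y) - Y (η X) - η [X, Y]` it is usually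
written as vanishing of `[φ, φ] + 2 dη ⊗ ξ`; the factor is absorbed by the normalization of
`DiffForm.extDer`. -/
def IsNormal (S : AlmostContactMetric k N) : Prop :=
  ∀ X Y : ContMDiffSection (𝓡 k) (EuclideanSpace ℝ (Fin k)) ∞
      (fun x : N ↦ TangentSpace (𝓡 k) x),
    ∀ x : N, S.nijenhuis X Y x + (DiffForm.ofCovector S.η).extDer x ![X x, Y x] • S.ξ x = 0

/-- Cosymplectic: normal, with closed `η` and closed fundamental two-form. -/
structure IsCosymplectic (S : AlmostContactMetric k N) : Prop where
  closed_η : ∀ x : N, (DiffForm.ofCovector S.η).extDer x = 0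
  closed_fundamentalForm : ∀ x : N, S.fundamentalForm.extDer x = 0
  normal : S.IsNormal

end AlmostContactMetric

end Contact

/-! ### Submanifolds -/

section Submanifold

/-- An immersed submanifold `M` of `N`: a smooth map with injective differentials (embedded
submanifolds are the special case of a topological embedding). -/
structure ImmersedSubmanifold (m k : ℕ) (M N : Type*)
    [TopologicalSpace M] [ChartedSpace (EuclideanSpace ℝ (Fin m)) M]
    [TopologicalSpace N] [ChartedSpace (EuclideanSpace ℝ (Fin k)) N] where
  toFun : M → N
  contMDiff : ContMDiff (𝓡 m) (𝓡 k) ∞ toFun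
  injective_mfderiv : ∀ p : M, Function.Injective (mfderiv (𝓡 m) (𝓡 k) toFun p)

namespace ImmersedSubmanifold

variable {m k : ℕ} {M N : Type*}
  [TopologicalSpace M] [ChartedSpace (EuclideanSpace ℝ (Fin m)) M]
  [TopologicalSpace N] [ChartedSpace (EuclideanSpace ℝ (Fin k)) N]

/-- The inclusion `T_p M → T_p N` of tangent spaces, i.e. the differential of the immersion. -/
noncomputable def incl (i : ImmersedSubmanifold m k M N) (p : M) :
    TangentSpace (𝓡 m) p →ₗ[ℝ] TangentSpace (𝓡 k) (i.toFun p) :=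
  (mfderiv (𝓡 m) (𝓡 k) i.toFun p).toLinearMap

theorem incl_injective (i : ImmersedSubmanifold m k M N) (p : M) :
    Function.Injective (i.incl p) := i.injective_mfderiv p

/-- The tangent space `T_p M` as a subspace of `T_p N`. -/
noncomputable def tangent (i : ImmersedSubmanifold m k M N) (p : M) :
    Submodule ℝ (TangentSpace (𝓡 k) (i.toFun p)) :=
  LinearMap.range (i.incl p)

variable [RiemannianBundle (fun x : N ↦ TangentSpace (𝓡 k) x)]

/-- The induced Riemannian metric on `M`. -/
noncomputable def inducedMetric (i : ImmersedSubmanifold m k M N) (p : M) :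
    TangentSpace (𝓡 m) p →ₗ[ℝ] TangentSpace (𝓡 m) p →ₗ[ℝ] ℝ :=
  (innerₗ (TangentSpace (𝓡 k) (i.toFun p))).compl₁₂ (i.incl p) (i.incl p)

/-- The tangential part `T_p N → T_p M` (orthogonal projection to `T_p M`). -/
noncomputable def tangentialPart (i : ImmersedSubmanifold m k M N) (p : M) :
    TangentSpace (𝓡 k) (i.toFun p) →ₗ[ℝ] TangentSpace (𝓡 m) p :=
  (LinearEquiv.ofInjective (i.incl p) (i.incl_injective p)).symm.toLinearMap ∘ₗ
    (i.tangent p).orthogonalProjectionOnto.toLinearMap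

theorem inner_incl_tangentialPart (i : ImmersedSubmanifold m k M N) (p : M)
    (X : TangentSpace (𝓡 m) p) (v : TangentSpace (𝓡 k) (i.toFun p)) :
    inner ℝ (i.incl p X) (i.incl p (i.tangentialPart p v)) = inner ℝ (i.incl p X) v := by
  have h1 : i.incl p (i.tangentialPart p v) = (i.tangent p).orthogonalProjectionOnto v :=
    congrArg Subtype.val ((LinearEquiv.ofInjective (i.incl p) (i.incl_injective p)).apply_symm_apply
      ((i.tangent p).orthogonalProjectionOnto v))
  rw [h1]
  exact Submodule.inner_orthogonalProjectionOnto_eq_of_mem_left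
    (K := i.tangent p) ⟨i.incl p X, LinearMap.mem_range_self _ X⟩ v

variable [IsManifold (𝓡 k) ∞ N]

/-- The tensor `T`: the tangential part of `φ X` for `X` tangent to `M`. -/
noncomputable def tensorT (i : ImmersedSubmanifold m k M N) (S : AlmostContactMetric k N)
    (p : M) : TangentSpace (𝓡 m) p →ₗ[ℝ] TangentSpace (𝓡 m) p :=
  i.tangentialPart p ∘ₗ (S.φ (i.toFun p)).toLinearMap ∘ₗ i.incl p

/-- The two-form `Ω (X, Y) = g (X, T Y)` on `M`. -/
noncomputable def formΩ (i : ImmersedSubmanifold m k M N) (S : AlmostContactMetric k N) :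
    DiffForm m M 2 :=
  DiffForm.ofBilin (fun p ↦ (i.inducedMetric p).compl₂ (i.tensorT S p))
    (fun p X ↦ (i.inner_incl_tangentialPart p X _).trans (S.inner_φ_self _ _))

theorem formΩ_apply (i : ImmersedSubmanifold m k M N) (S : AlmostContactMetric k N) (p : M)
    (X Y : TangentSpace (𝓡 m) p) :
    i.formΩ S p ![X, Y] = i.inducedMetric p X (i.tensorT S p Y) := rfl

/-- The space `M_p` of all vectors tangent to `M` at `p` that are orthogonal to `ξ`, seen as a
subspace of `T_p N`. -/
noncomputable def slantSpace (i : ImmersedSubmanifold m k M N) (S : AlmostContactMetric k N)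
    (p : M) : Submodule ℝ (TangentSpace (𝓡 k) (i.toFun p)) :=
  i.tangent p ⊓ (Submodule.span ℝ {S.ξ (i.toFun p)})ᗮ

/-- The angle in `[0, π / 2]` between a nonzero vector and a subspace: its cosine is the length of
the orthogonal projection divided by the length of the vector. -/
noncomputable def angleSubspace {E : Type*} [NormedAddCommGroup E] [InnerProductSpace ℝ E]
    (v : E) (W : Submodule ℝ E) [W.HasOrthogonalProjection] : ℝ :=
  Real.arccos (‖W.orthogonalProjectionOnto v‖ / ‖v‖)

/-- `θ` is a slant function of `M`: at each `p`, the angle between `φ X` and `M_p` equals `θ p`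
for all nonzero `X` in `M_p`. -/
def IsSlantFunction (i : ImmersedSubmanifold m k M N) (S : AlmostContactMetric k N)
    (θ : M → ℝ) : Prop :=
  ∀ p : M, ∀ X ∈ i.slantSpace S p, X ≠ 0 →
    angleSubspace (S.φ (i.toFun p) X) (i.slantSpace S p) = θ p

/-- A proper pointwise slant submanifold: there is a slant function, with values in
`[0, π / 2)`. -/
def IsProperPointwiseSlant (i : ImmersedSubmanifold m k M N) (S : AlmostContactMetric k N) :
    Prop :=
  ∃ θ : M → ℝ, i.IsSlantFunction S θ ∧ ∀ p : M, θ p ∈ Set.Ico 0 (Real.pi / 2)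

end ImmersedSubmanifold

end Submanifold

/-- A map into the continuous alternating maps on a finite-dimensional space is smooth as soon as
all its evaluations are. -/
theorem contDiffOn_continuousAlternatingMap_of_apply {E V ι : Type*} [NormedAddCommGroup E]
    [NormedSpace ℝ E] [NormedAddCommGroup V] [NormedSpace ℝ V] [FiniteDimensional ℝ V]
    [Fintype ι] {n : WithTop ℕ∞} {f : E → V [⋀^ι]→L[ℝ] ℝ} {s : Set E}
    (h : ∀ v : ι → V, ContDiffOn ℝ n (fun y ↦ f y v) s) : ContDiffOn ℝ n f s := by
  classical
  let b := Module.finBasis ℝ V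
  let L : (V [⋀^ι]→L[ℝ] ℝ) →ₗ[ℝ] ((ι → Fin (Module.finrank ℝ V)) → ℝ) :=
    { toFun := fun β j ↦ β fun a ↦ b (j a)
      map_add' := fun _ _ ↦ rfl
      map_smul' := fun _ _ ↦ rfl }
  have hL : Function.Injective L := by
    intro β β' hβ
    apply ContinuousAlternatingMap.toAlternatingMap_injective
    exact Module.Basis.ext_alternating b fun j _ ↦ congrFun hβ j
  obtain ⟨R, hR⟩ := L.exists_leftInverse_of_injective (LinearMap.ker_eq_bot.2 hL)
  have hf : f = fun y ↦ R (L (f y)) := funext fun y ↦ (LinearMap.congr_fun hR (f y)).symm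
  rw [hf]
  exact (LinearMap.toContinuousLinearMap R).contDiff.comp_contDiffOn
    (contDiffOn_pi.2 fun j ↦ h _)

/-- The coordinate vector fields of a chart are smooth. -/
theorem contMDiffOn_mfderiv_extChartAt_symm {d : ℕ} {M : Type*} [TopologicalSpace M]
    [ChartedSpace (EuclideanSpace ℝ (Fin d)) M] [IsManifold (𝓡 d) ∞ M] (x₀ : M)
    (v : EuclideanSpace ℝ (Fin d)) :
    ContMDiffOn (𝓡 d) (𝓡 d).tangent ∞
      (fun y ↦ (⟨(extChartAt (𝓡 d) x₀).symm y,
        mfderiv (𝓡 d) (𝓡 d) (extChartAt (𝓡 d) x₀).symm y v⟩ : TangentBundle (𝓡 d) M))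
      (extChartAt (𝓡 d) x₀).target := by
  have ho : IsOpen (extChartAt (𝓡 d) x₀).target := isOpen_extChartAt_target x₀
  have h := (contMDiffOn_extChartAt_symm (I := 𝓡 d) (n := ∞) x₀).contMDiffOn_tangentMapWithin
    (m := ∞) le_rfl ho.uniqueMDiffOn
  have hc : ContMDiff (𝓡 d) (𝓡 d).tangent ∞
      (fun y : EuclideanSpace ℝ (Fin d) ↦
        (⟨y, v⟩ : TangentBundle (𝓡 d) (EuclideanSpace ℝ (Fin d)))) := by
    intro y
    rw [Bundle.contMDiffAt_totalSpace]
    refine ⟨contMDiffAt_id, ?_⟩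
    simpa using contMDiffAt_const
  refine (h.comp hc.contMDiffOn fun y hy ↦ hy).congr fun y hy ↦ ?_
  simp only [Function.comp, tangentMapWithin, mfderivWithin_of_mem_nhds (ho.mem_nhds hy)]

namespace DiffForm

variable {k : ℕ} {N : Type*} [TopologicalSpace N] [ChartedSpace (EuclideanSpace ℝ (Fin k)) N]

/-- The pullback of a form under a map only depends on the germ of the map. -/
theorem compContinuousLinearMap_mfderiv_congr {d r : ℕ} (α : DiffForm k N r)
    {f g : EuclideanSpace ℝ (Fin d) → N} {y : EuclideanSpace ℝ (Fin d)} (h : f =ᶠ[nhds y] g) :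
    (α (f y)).compContinuousLinearMap (mfderiv (𝓡 d) (𝓡 k) f y) =
      (α (g y)).compContinuousLinearMap (mfderiv (𝓡 d) (𝓡 k) g y) := by
  have aux : ∀ (q q' : N) (L L' : EuclideanSpace ℝ (Fin d) →L[ℝ] EuclideanSpace ℝ (Fin k)),
      q = q' → L = L' →
      (α q).compContinuousLinearMap (L : _ →L[ℝ] TangentSpace (𝓡 k) q) =
        (α q').compContinuousLinearMap (L' : _ →L[ℝ] TangentSpace (𝓡 k) q') := by
    rintro q _ L _ rfl rfl
    rfl
  exact aux _ _ _ _ h.eq_of_nhds h.mfderiv_eq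

variable {m : ℕ} {M : Type*} [TopologicalSpace M] [ChartedSpace (EuclideanSpace ℝ (Fin m)) M]
  [IsManifold (𝓡 m) ∞ M] [IsManifold (𝓡 k) ∞ N]

/-- The local representative of a pullback is the pullback of the local representative under the
coordinate expression of the map. -/
theorem chartRep_pullback_eventuallyEq {r : ℕ} (α : DiffForm k N r) {f : M → N}
    (hf : ContMDiff (𝓡 m) (𝓡 k) ∞ f) (x : M) :
    chartRep (fun p ↦ (α (f p)).compContinuousLinearMap (mfderiv (𝓡 m) (𝓡 k) f p)) x
      =ᶠ[nhds (extChartAt (𝓡 m) x x)]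
    fun y ↦ (α.chartRep (f x) (writtenInExtChartAt (𝓡 m) (𝓡 k) x f y)).compContinuousLinearMap
      (fderiv ℝ (writtenInExtChartAt (𝓡 m) (𝓡 k) x f) y) := by
  have ht : (extChartAt (𝓡 m) x).target ∈ nhds (extChartAt (𝓡 m) x x) :=
    extChartAt_target_mem_nhds x
  have hs : (extChartAt (𝓡 m) x).symm ⁻¹' (f ⁻¹' (extChartAt (𝓡 k) (f x)).source) ∈
      nhds (extChartAt (𝓡 m) x x) := by
    refine (continuousAt_extChartAt_symm x).preimage_mem_nhds ?_
    rw [extChartAt_to_inv]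
    exact hf.continuous.continuousAt.preimage_mem_nhds (extChartAt_source_mem_nhds (f x))
  filter_upwards [eventually_mem_nhds_iff.2 ht, eventually_mem_nhds_iff.2 hs] with y hy hy'
  have hψ : MDifferentiableAt (𝓡 m) (𝓡 m) (extChartAt (𝓡 m) x).symm y :=
    ((contMDiffOn_extChartAt_symm (n := ∞) x).contMDiffAt hy).mdifferentiableAt (by simp)
  have hfd : MDifferentiableAt (𝓡 m) (𝓡 k) f ((extChartAt (𝓡 m) x).symm y) :=
    hf.mdifferentiableAt (by simp)
  have hq : f ((extChartAt (𝓡 m) x).symm y) ∈ (extChartAt (𝓡 k) (f x)).source :=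
    mem_of_mem_nhds (x := y) hy'
  have hχ : MDifferentiableAt (𝓡 k) (𝓡 k) (extChartAt (𝓡 k) (f x))
      (f ((extChartAt (𝓡 m) x).symm y)) :=
    mdifferentiableAt_extChartAt (by rwa [extChartAt_source] at hq)
  have hF : MDifferentiableAt (𝓡 m) (𝓡 k) (writtenInExtChartAt (𝓡 m) (𝓡 k) x f) y :=
    hχ.comp y (hfd.comp y hψ)
  have hχs : MDifferentiableAt (𝓡 k) (𝓡 k) (extChartAt (𝓡 k) (f x)).symm
      (writtenInExtChartAt (𝓡 m) (𝓡 k) x f y) :=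
    ((contMDiffOn_extChartAt_symm (n := ∞) (f x)).contMDiffAt
      ((isOpen_extChartAt_target (f x)).mem_nhds
        ((extChartAt (𝓡 k) (f x)).map_source hq))).mdifferentiableAt (by simp)
  have hgerm : f ∘ (extChartAt (𝓡 m) x).symm =ᶠ[nhds y]
      (extChartAt (𝓡 k) (f x)).symm ∘ writtenInExtChartAt (𝓡 m) (𝓡 k) x f := by
    filter_upwards [hy'] with z hz
    exact ((extChartAt (𝓡 k) (f x)).left_inv hz).symm
  have h := compContinuousLinearMap_mfderiv_congr α hgerm
  rw [mfderiv_comp y hfd hψ, mfderiv_comp y hχs hF, mfderiv_eq_fderiv] at h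
  exact h

/-- The pullback of a form with smooth local representative at `f x` and vanishing exterior
derivative there has vanishing exterior derivative at `x`. -/
theorem extDer_pullback_eq_zero {r : ℕ} {α : DiffForm k N r} (hα : α.IsSmooth) {f : M → N}
    (hf : ContMDiff (𝓡 m) (𝓡 k) ∞ f) (x : M) (h : α.extDer (f x) = 0) :
    extDer (fun p ↦ (α (f p)).compContinuousLinearMap (mfderiv (𝓡 m) (𝓡 k) f p)) x = 0 := by
  have hF0 : writtenInExtChartAt (𝓡 m) (𝓡 k) x f (extChartAt (𝓡 m) x x) =
      extChartAt (𝓡 k) (f x) (f x) := by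
    simp [writtenInExtChartAt]
  have hFd : ContDiffAt ℝ ∞ (writtenInExtChartAt (𝓡 m) (𝓡 k) x f) (extChartAt (𝓡 m) x x) := by
    have := (contMDiffAt_iff.1 (hf x)).2
    simpa [← contDiffWithinAt_univ] using this
  have hω : DifferentiableAt ℝ (α.chartRep (f x))
      (writtenInExtChartAt (𝓡 m) (𝓡 k) x f (extChartAt (𝓡 m) x x)) := by
    rw [hF0]
    exact ((hα (f x)).contDiffAt (extChartAt_target_mem_nhds (f x))).differentiableAt (by simp)
  have h0 : extDeriv (α.chartRep (f x)) (extChartAt (𝓡 k) (f x) (f x)) = 0 := by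
    have hinv := isInvertible_mfderiv_extChartAt (I := 𝓡 k) (mem_extChartAt_source (f x))
    ext v
    obtain ⟨e, he⟩ := hinv
    have hv : (fun j ↦ mfderiv (𝓡 k) (𝓡 k) (extChartAt (𝓡 k) (f x)) (f x) (e.symm (v j))) = v := by
      rw [← he]
      exact funext fun j ↦ e.apply_symm_apply (v j)
    have := congrArg (fun β ↦ β fun j ↦ e.symm (v j)) h
    simp only [extDer_apply, hv] at this
    exact this
  ext v
  rw [extDer_apply, (chartRep_pullback_eventuallyEq α hf x).extDeriv_eq,
    extDeriv_pullback (r := ∞) hω hFd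
      (by simpa using (WithTop.coe_le_coe.2 le_top : ((2 : ℕ∞) : WithTop ℕ∞) ≤ ∞)), hF0, h0]
  rfl

end DiffForm

section

variable {k : ℕ} {N : Type*} [TopologicalSpace N] [ChartedSpace (EuclideanSpace ℝ (Fin k)) N]
  [IsManifold (𝓡 k) ∞ N] [RiemannianBundle (fun x : N ↦ TangentSpace (𝓡 k) x)]

namespace AlmostContactMetric

/-- The fundamental form is smooth along smooth vector fields over a map. -/
theorem contDiffOn_inner_φ
    [IsContMDiffRiemannianBundle (𝓡 k) ∞ (EuclideanSpace ℝ (Fin k))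
      (fun x : N ↦ TangentSpace (𝓡 k) x)]
    (S : AlmostContactMetric k N) {d : ℕ}
    {s : Set (EuclideanSpace ℝ (Fin d))} {b : EuclideanSpace ℝ (Fin d) → N}
    {V W : ∀ y, TangentSpace (𝓡 k) (b y)}
    (hV : ContMDiffOn (𝓡 d) (𝓡 k).tangent ∞ (fun y ↦ (⟨b y, V y⟩ : TangentBundle (𝓡 k) N)) s)
    (hW : ContMDiffOn (𝓡 d) (𝓡 k).tangent ∞ (fun y ↦ (⟨b y, W y⟩ : TangentBundle (𝓡 k) N)) s) :
    ContDiffOn ℝ ∞ (fun y ↦ inner ℝ (V y) (S.φ (b y) (W y))) s := by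
  have hb : ContMDiffOn (𝓡 d) (𝓡 k) ∞ b s := fun y hy ↦
    (Bundle.contMDiffWithinAt_totalSpace.1 (hV y hy)).1
  have hφ := S.φ.contMDiff.comp_contMDiffOn hb
  have hφW := ContMDiffOn.clm_bundle_apply (F₁ := EuclideanSpace ℝ (Fin k))
    (F₂ := EuclideanSpace ℝ (Fin k)) (E₁ := fun x : N ↦ TangentSpace (𝓡 k) x)
    (E₂ := fun x : N ↦ TangentSpace (𝓡 k) x) hφ hW
  exact (ContMDiffOn.inner_bundle (E := fun x : N ↦ TangentSpace (𝓡 k) x) hV hφW).contDiffOn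

theorem fundamentalForm_isSmooth
    [IsContMDiffRiemannianBundle (𝓡 k) ∞ (EuclideanSpace ℝ (Fin k))
      (fun x : N ↦ TangentSpace (𝓡 k) x)]
    (S : AlmostContactMetric k N) :
    S.fundamentalForm.IsSmooth := fun x₀ ↦
  contDiffOn_continuousAlternatingMap_of_apply fun v ↦
    S.contDiffOn_inner_φ (contMDiffOn_mfderiv_extChartAt_symm x₀ (v 0))
      (contMDiffOn_mfderiv_extChartAt_symm x₀ (v 1))

end AlmostContactMetric

namespace ImmersedSubmanifold

variable {m : ℕ} {M : Type*} [TopologicalSpace M] [ChartedSpace (EuclideanSpace ℝ (Fin m)) M]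

/-- `Ω` is the pullback of the fundamental form. -/
theorem formΩ_eq_pullback (i : ImmersedSubmanifold m k M N) (S : AlmostContactMetric k N) :
    i.formΩ S = fun p ↦ (S.fundamentalForm (i.toFun p)).compContinuousLinearMap
      (mfderiv (𝓡 m) (𝓡 k) i.toFun p) := by
  funext p
  ext v
  exact i.inner_incl_tangentialPart p (v 0) _

theorem formΩ_isSmooth [IsManifold (𝓡 m) ∞ M]
    [IsContMDiffRiemannianBundle (𝓡 k) ∞ (EuclideanSpace ℝ (Fin k))
      (fun x : N ↦ TangentSpace (𝓡 k) x)]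
    (i : ImmersedSubmanifold m k M N) (S : AlmostContactMetric k N) :
    (i.formΩ S).IsSmooth := fun x₀ ↦ by
  have hT := i.contMDiff.contMDiff_tangentMap (m := ∞) le_rfl
  rw [formΩ_eq_pullback]
  exact contDiffOn_continuousAlternatingMap_of_apply fun v ↦
    S.contDiffOn_inner_φ
      (hT.comp_contMDiffOn (contMDiffOn_mfderiv_extChartAt_symm x₀ (v 0)))
      (hT.comp_contMDiffOn (contMDiffOn_mfderiv_extChartAt_symm x₀ (v 1)))

end ImmersedSubmanifold

end

theorem theorem5p2 {n m : ℕ}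
    {N : Type*} [TopologicalSpace N] [T2Space N]
    [ChartedSpace (EuclideanSpace ℝ (Fin (2 * n + 1))) N] [IsManifold (𝓡 (2 * n + 1)) ∞ N]
    [RiemannianBundle (fun x : N ↦ TangentSpace (𝓡 (2 * n + 1)) x)]
    [IsContMDiffRiemannianBundle (𝓡 (2 * n + 1)) ∞ (EuclideanSpace ℝ (Fin (2 * n + 1)))
      (fun x : N ↦ TangentSpace (𝓡 (2 * n + 1)) x)]
    {M : Type*} [TopologicalSpace M] [T2Space M]
    [ChartedSpace (EuclideanSpace ℝ (Fin m)) M] [IsManifold (𝓡 m) ∞ M]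
    (S : AlmostContactMetric (2 * n + 1) N) (hS : S.IsCosymplectic)
    (i : ImmersedSubmanifold m (2 * n + 1) M N) (hi : i.IsProperPointwiseSlant S) :
    (i.formΩ S).IsClosed := by
  refine ⟨i.formΩ_isSmooth S, fun p ↦ ?_⟩
  rw [i.formΩ_eq_pullback]
  exact DiffForm.extDer_pullback_eq_zero S.fundamentalForm_isSmooth i.contMDiff p
    (hS.closed_fundamentalForm _)
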